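/- Let $d,q\ge 1$ be integers. Let $T$ be a regular $(q+1)$-valent tree in which each vertex has a single predecessor and $q$ successors, with a basepoint $o$. For vertices $v,w$ let $v\curlywedge w$ be their greatest common ancestor, and put $m(v)=d_T(o,o\curlywedge v)$, $l(v)=d_T(v,o\curlywedge v)$, $h(v)=l(v)-m(v)$. The Diestel–Leader graph $DL_d(q)$ has as vertices the $d$-tuples $x=(x_1,\dots,x_d)$ of vertices of $T$ with $\sum_i h(x_i)=0$; two vertices $x,y$ are adjacent if there are $i\ne j$ such that $x_i,y_i$ are adjacent in $T$, $x_j,y_j$ are adjacent in $T$, and $x_k=y_k$ for all $k\notin\{i,j\}$. Write $m_i(x)=m(x_i)$, $h_i(x)=h(x_i)$, $id=(o,\dots,o)$, and let $d(\cdot,\cdot)$ be the path distance in $DL_d(q)$ (equal to $\infty$ between vertices not joined by a path, which happens only for $d=1$). Let $x,z\in DL_d(q)$ and suppose $h_i(z)=0$ for every $1\le i\le d$. Then: 1. If $m_i(z)<m_i(x)$ for each $i$ with $m_i(x)\ne 0$, and $m_i(z)=0$ for each $i$ with $m_i(x)=0$, then $d(x,z)=d(x,id)$. 2. If $m_i(z)\le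 m_i(x)$ for each $i$, then $d(x,z)\le d(x,id)$. 3. If $m_i(z)\ne m_i(x)$ for each $i$ with $m_i(x)\neq 0$, then $d(x,z)\ge d(x,id)+\sum_{i=1}^d \max\{0,\,m_i(z)-m_i(x)\}$. -/

import Mathlib

open Function

/-- A regular `(q+1)`-valent tree in which every vertex `v` has a single predecessor `pred v` and
`q` successors (the vertices whose predecessor is `v`), the neighbours of `v` being its predecessor
and its successors, together with a basepoint `o`. -/
structure HorocyclicTree (q : ℕ) (V : Type*) where
  graph : SimpleGraph V
  isTree : graph.IsTree
  regular : ∀ v, (graph.neighborSet v).encard = q + 1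
  pred : V → V
  adj_iff : ∀ v w, graph.Adj v w ↔ pred v = w ∨ pred w = v
  successors : ∀ v, {w | pred w = v}.encard = q
  o : V

namespace HorocyclicTree

variable {q : ℕ} {V : Type*} (T : HorocyclicTree q V)

/-- `u` is an ancestor of `v` (every vertex is an ancestor of itself). -/
def IsAncestor (u v : V) : Prop := ∃ n : ℕ, T.pred^[n] v = u

/-- `u` is the greatest common ancestor of `v` and `w`: a common ancestor such that every common
ancestor is an ancestor of `u`. -/
def IsGreatestCommonAncestor (v w u : V) : Prop :=
  T.IsAncestor u v ∧ T.IsAncestor u w ∧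
    ∀ u', T.IsAncestor u' v → T.IsAncestor u' w → T.IsAncestor u' u

theorem exists_commonAncestor (v w : V) : ∃ u, T.IsAncestor u v ∧ T.IsAncestor u w := by
  obtain ⟨p⟩ := T.isTree.connected.preconnected v w
  induction p with
  | nil => exact ⟨_, ⟨0, rfl⟩, ⟨0, rfl⟩⟩
  | @cons a b c hab _ ih =>
    obtain ⟨u, ⟨n, hn⟩, ⟨k, hk⟩⟩ := ih
    rcases (T.adj_iff a b).1 hab with h | h
    · exact ⟨u, ⟨n + 1, by rw [iterate_succ_apply, h, hn]⟩, ⟨k, hk⟩⟩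
    · cases n with
      | zero =>
        refine ⟨a, ⟨0, rfl⟩, ⟨k + 1, ?_⟩⟩
        rw [iterate_succ_apply', hk, ← hn]
        exact h
      | succ n => exact ⟨u, ⟨n, by rw [← hn, iterate_succ_apply, h]⟩, ⟨k, hk⟩⟩

theorem exists_isGreatestCommonAncestor (v w : V) : ∃ u, T.IsGreatestCommonAncestor v w u := by
  classical
  have hex : ∃ k : ℕ, T.IsAncestor (T.pred^[k] v) w := by
    obtain ⟨u, ⟨n, hn⟩, hu⟩ := T.exists_commonAncestor v w
    exact ⟨n, hn ▸ hu⟩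
  refine ⟨T.pred^[Nat.find hex] v, ⟨_, rfl⟩, Nat.find_spec hex, ?_⟩
  rintro u' ⟨n, rfl⟩ hw
  have hle : Nat.find hex ≤ n := Nat.find_min' hex hw
  exact ⟨n - Nat.find hex, by rw [← iterate_add_apply, Nat.sub_add_cancel hle]⟩

/-- The greatest common ancestor of two vertices. -/
noncomputable def meet (v w : V) : V := (T.exists_isGreatestCommonAncestor v w).choose

/-- `m(v) = d(o, o ⋏ v)`. -/
noncomputable def m (v : V) : ℕ := T.graph.dist T.o (T.meet T.o v)

/-- `l(v) = d(v, o ⋏ v)`. -/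
noncomputable def l (v : V) : ℕ := T.graph.dist v (T.meet T.o v)

/-- `h(v) = l(v) - m(v)`. -/
noncomputable def h (v : V) : ℤ := (T.l v : ℤ) - (T.m v : ℤ)

theorem h_o : T.h T.o = 0 := by simp [h, l, m]

/-- The vertices of the Diestel-Leader graph `DL_d(q)` built from `d` copies of the tree `T`. -/
def DLVertex (d : ℕ) : Type _ := {v : Fin d → V // ∑ i, T.h (v i) = 0}

/-- The Diestel-Leader graph `DL_d(q)`. -/
def DL (d : ℕ) : SimpleGraph (T.DLVertex d) where
  Adj v w := ∃ i j : Fin d, i ≠ j ∧ T.graph.Adj (v.1 i) (w.1 i) ∧ T.graph.Adj (v.1 j) (w.1 j) ∧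
    ∀ k, k ≠ i → k ≠ j → v.1 k = w.1 k
  symm := ⟨by
    rintro v w ⟨i, j, hij, hi, hj, hk⟩
    exact ⟨i, j, hij, hi.symm, hj.symm, fun k h1 h2 => (hk k h1 h2).symm⟩⟩
  loopless := ⟨by
    rintro v ⟨i, j, hij, hi, hj, hk⟩
    exact T.graph.loopless.irrefl _ hi⟩

/-- The basepoint `id = (o, …, o)` of `DL_d(q)`. -/
def DLid (d : ℕ) : T.DLVertex d := ⟨fun _ => T.o, by simp [h_o]⟩

end HorocyclicTree

/-! The trees exist for every `q ≥ 1`. A vertex at height `n` is given by the labels of the edges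
on its descending path, all but finitely many of which are zero. -/

theorem isAcyclic_of_pred {V : Type*} (G : SimpleGraph V) (pred : V → V) (ht : V → ℤ)
    (hht : ∀ v, ht (pred v) = ht v - 1) (hG : ∀ v w, G.Adj v w ↔ pred v = w ∨ pred w = v) :
    G.IsAcyclic := by
  have hit : ∀ (n : ℕ) v, ht (pred^[n] v) = ht v - n := by
    intro n
    induction n with
    | zero => simp
    | succ n ih => intro v; rw [iterate_succ_apply, ih, hht]; push_cast; ring
  have key : ∀ v, ¬ (G \ SimpleGraph.fromEdgeSet {s(v, pred v)}).Reachable v (pred v) := by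
    rintro v ⟨p⟩
    have hinv : ∀ a b, (G \ SimpleGraph.fromEdgeSet {s(v, pred v)}).Walk a b →
        (∃ n : ℕ, pred^[n] a = v) → ∃ n : ℕ, pred^[n] b = v := by
      intro a b p
      induction p with
      | nil => exact id
      | @cons a c b hac _ ih =>
        rintro ⟨n, hn⟩
        apply ih
        rw [SimpleGraph.sdiff_adj, SimpleGraph.fromEdgeSet_adj] at hac
        obtain ⟨hac, hne⟩ := hac
        rcases (hG _ _).1 hac with h | h
        · cases n with
          | zero =>
            exfalso
            apply hne
            have : a = v := hn
            subst this
            exact ⟨by simp [h], hac.ne⟩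
          | succ n => exact ⟨n, by rw [← hn, iterate_succ_apply, h]⟩
        · exact ⟨n + 1, by rw [iterate_succ_apply, h, hn]⟩
    obtain ⟨n, hn⟩ := hinv _ _ p ⟨0, rfl⟩
    have h1 := hit n (pred v)
    rw [hn, hht] at h1
    omega
  rw [SimpleGraph.isAcyclic_iff_forall_adj_isBridge]
  intro v w hvw
  rw [SimpleGraph.isBridge_iff]
  rcases (hG _ _).1 hvw with h | h
  · subst h
    exact key v
  · subst h
    rw [Sym2.eq_swap]
    exact fun hr => key w hr.symm

theorem exists_horocyclicTree (q : ℕ) (hq : 1 ≤ q) :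
    ∃ V : Type, Nonempty (HorocyclicTree q V) := by
  classical
  have : NeZero q := ⟨by omega⟩
  let V : Type := {p : ℤ × (ℤ → Fin q) //
    (∀ k, p.1 ≤ k → p.2 k = 0) ∧ ∃ N, ∀ k < N, p.2 k = 0}
  let pred : V → V := fun v => ⟨(v.1.1 - 1, update v.1.2 (v.1.1 - 1) 0), by
    obtain ⟨⟨n, f⟩, h1, N, h2⟩ := v
    refine ⟨fun k hk => ?_, N, fun k hk => ?_⟩
    · by_cases hkn : k = n - 1
      · simp [hkn]
      · have : n ≤ k := by have : n - 1 ≤ k := hk; omega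
        simpa [update_apply, hkn] using h1 k this
    · by_cases hkn : k = n - 1
      · simp [hkn]
      · simpa [update_apply, hkn] using h2 k hk⟩
  let ht : V → ℤ := fun v => v.1.1
  have hht : ∀ v, ht (pred v) = ht v - 1 := fun v => rfl
  let G : SimpleGraph V :=
    { Adj := fun v w => pred v = w ∨ pred w = v
      symm := ⟨fun v w h => h.symm⟩
      loopless := ⟨fun v h => by
        have := hht v
        rcases h with h | h <;> rw [h] at this <;> omega⟩ }
  have hG : ∀ v w, G.Adj v w ↔ pred v = w ∨ pred w = v := fun v w => Iff.rfl
  let root : ℤ → V := fun n => ⟨(n, fun _ => 0), by simp⟩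
  have hroot : ∀ n, pred (root n) = root (n - 1) := by
    intro n
    apply Subtype.ext
    simp [pred, root]
  have hreach : ∀ v (n : ℕ), G.Reachable v (pred^[n] v) := by
    intro v n
    induction n with
    | zero => exact SimpleGraph.Reachable.refl _
    | succ n ih =>
      refine ih.trans (SimpleGraph.Adj.reachable ?_)
      rw [iterate_succ_apply']
      exact Or.inl rfl
  have hform : ∀ (v : V) (n : ℕ), (pred^[n] v).1.1 = v.1.1 - n ∧
      ∀ k, k < v.1.1 - n → (pred^[n] v).1.2 k = v.1.2 k := by
    intro v n
    induction n with
    | zero => simp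
    | succ n ih =>
      rw [iterate_succ_apply']
      refine ⟨?_, fun k hk => ?_⟩
      · change (pred^[n] v).1.1 - 1 = _
        rw [ih.1]; push_cast; ring
      · change update (pred^[n] v).1.2 ((pred^[n] v).1.1 - 1) 0 k = _
        push_cast at hk
        rw [ih.1, update_of_ne (by omega), ih.2 k (by omega)]
  have hdown : ∀ v : V, ∃ N : ℤ, ∀ M ≤ N, G.Reachable v (root M) := by
    intro v
    obtain ⟨N, hN⟩ := v.2.2
    refine ⟨min N v.1.1, fun M hM => ?_⟩
    have h1 : M ≤ N := hM.trans (min_le_left _ _)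
    have h2 : M ≤ v.1.1 := hM.trans (min_le_right _ _)
    obtain ⟨n, hn⟩ := Int.eq_ofNat_of_zero_le (sub_nonneg.2 h2)
    have h3 := hreach v n
    have h4 := hform v n
    have : pred^[n] v = root M := by
      apply Subtype.ext
      refine Prod.ext (by rw [h4.1]; change _ = M; omega) (funext fun k => ?_)
      change _ = 0
      by_cases hk : k < M
      · rw [h4.2 k (by omega)]; exact hN k (by omega)
      · exact (pred^[n] v).2.1 k (by rw [h4.1]; omega)
    rwa [this] at h3
  have hconn : G.Connected := by
    have : Nonempty V := ⟨root 0⟩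
    refine ⟨fun v w => ?_⟩
    obtain ⟨N, hN⟩ := hdown v
    obtain ⟨M, hM⟩ := hdown w
    exact (hN (min N M) (min_le_left _ _)).trans (hM (min N M) (min_le_right _ _)).symm
  have hsucc : ∀ v, {w | pred w = v}.encard = q := by
    intro v
    let e : Fin q → V := fun a => ⟨(v.1.1 + 1, update v.1.2 v.1.1 a), by
      obtain ⟨⟨n, f⟩, h1, N, h2⟩ := v
      refine ⟨fun k hk => ?_, min N n, fun k hk => ?_⟩
      · have hk : n + 1 ≤ k := hk
        change update f n a k = 0
        rw [update_of_ne (by omega)]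
        exact h1 k (by change n ≤ k; omega)
      · change update f n a k = 0
        have := lt_min_iff.1 hk
        rw [update_of_ne (by omega)]
        exact h2 k this.1⟩
    have he : Injective e := by
      intro a b hab
      have := congrFun (congrArg (fun u : V => u.1.2) hab) v.1.1
      simpa [e] using this
    have hset : {w | pred w = v} = Set.range e := by
      ext w
      simp only [Set.mem_ofPred_eq, Set.mem_range]
      constructor
      · rintro rfl
        refine ⟨w.1.2 (w.1.1 - 1), Subtype.ext ?_⟩
        simp [e, pred]
      · rintro ⟨a, rfl⟩
        apply Subtype.ext
        have : v.1.2 v.1.1 = 0 := v.2.1 _ le_rfl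
        refine Prod.ext (by simp [e, pred]) ?_
        simp [e, pred, ← this]
    rw [hset, ← Set.image_univ, he.encard_image, Set.encard_univ]
    simp
  refine ⟨V, ⟨⟨G, ⟨hconn, isAcyclic_of_pred G pred ht hht hG⟩, ?_, pred, hG, hsucc, root 0⟩⟩⟩
  intro v
  have : G.neighborSet v = insert (pred v) {w | pred w = v} := by
    ext w
    simp only [SimpleGraph.mem_neighborSet, hG, Set.mem_insert_iff, Set.mem_ofPred_eq]
    exact or_congr_left eq_comm
  rw [this, Set.encard_insert_of_notMem, hsucc]
  intro h
  have h1 := hht (pred v)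
  have h : pred (pred v) = v := h
  rw [h, hht] at h1
  omega

/-! Distances in the Diestel-Leader graph are decided by heights alone. Heights drop by one towards
ancestors, and a step of a walk moves one unit of height between two coordinates. In coordinate `i`
a walk from `x` to `z` must descend to a common ancestor of `x_i` and `z_i`
(`exists_height_profile`). Conversely, a height profile with the right ends that descends this far
in every coordinate lifts to a walk with as many steps as the profile has moves
(`edist_le_moveCount`).

Since `z` and `id` have the same heights, only the required depths differ. For `id` the depth is
`-m_i(x)`. If `m_i(z) ≤ m_i(x)`, then `o ⋏ x_i` is also an ancestor of `z_i`, so a profile for `id`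
serves for `z`. If `m_i(z) ≠ m_i(x)` whenever `m_i(x) ≠ 0`, the depth for `z` is at least `max
(m_i(x)) (m_i(z))` (`h_le_neg_max`), and each excess unit of depth can be cut off at a gain of one
move (`exists_shortened`). -/

namespace HorocyclicTree

variable {q d : ℕ} {V : Type*} (T : HorocyclicTree q V)

/-! ### Ancestors, heights and meets in the tree -/

theorem adj_pred (v : V) : T.graph.Adj v (T.pred v) := (T.adj_iff _ _).2 (Or.inl rfl)

/-- Otherwise the predecessor would be one of the `q` successors, leaving only `q` neighbours
instead of `q + 1`. -/
theorem pred_pred_ne (v : V) : T.pred (T.pred v) ≠ v := by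
  intro h
  have hset : T.graph.neighborSet v = {w | T.pred w = v} := by
    ext w
    simp only [SimpleGraph.mem_neighborSet, T.adj_iff, Set.mem_ofPred_eq]
    exact ⟨fun hw => hw.elim (fun hw => hw ▸ h) id, Or.inr⟩
  have h1 := T.regular v
  rw [hset, T.successors] at h1
  norm_cast at h1
  omega

/-- The walk from a vertex to its `n`-th ancestor. -/
def predWalk : ∀ (n : ℕ) (v : V), T.graph.Walk v (T.pred^[n] v)
  | 0, _ => .nil
  | n + 1, v => .cons (T.adj_pred v) (predWalk n (T.pred v))

theorem length_predWalk (n : ℕ) (v : V) : (T.predWalk n v).length = n := by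
  induction n generalizing v with
  | zero => rfl
  | succ n ih =>
    change (T.predWalk n (T.pred v)).length + 1 = n + 1
    rw [ih]

theorem isPath_predWalk (n : ℕ) (v : V) : (T.predWalk n v).IsPath := by
  -- In an acyclic graph it is enough that the walk never backtracks along the edge just used.
  rw [T.isTree.isAcyclic.isPath_iff_isChain]
  induction n generalizing v with
  | zero => exact List.isChain_nil
  | succ n ih =>
    cases n with
    | zero => exact List.isChain_singleton _
    | succ n =>
      refine List.isChain_cons_cons.2 ⟨?_, ih (T.pred v)⟩
      intro h
      rcases Sym2.eq_iff.1 h with h | h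
      · exact (T.adj_pred v).ne h.1
      · exact T.pred_pred_ne v h.1.symm

theorem dist_iterate_pred (n : ℕ) (v : V) : T.graph.dist v (T.pred^[n] v) = n := by
  obtain ⟨p, hp, hl⟩ := T.isTree.connected.exists_path_of_dist v (T.pred^[n] v)
  rw [← hl, (T.isTree.existsUnique_path _ _).unique hp (T.isPath_predWalk n v),
    T.length_predWalk]

theorem iterate_pred_inj {a b : ℕ} {v : V} (h : T.pred^[a] v = T.pred^[b] v) : a = b := by
  rw [← T.dist_iterate_pred a v, h, T.dist_iterate_pred]

theorem meet_spec (v w : V) : T.IsGreatestCommonAncestor v w (T.meet v w) :=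
  (T.exists_isGreatestCommonAncestor v w).choose_spec

theorem iterate_pred_l (v : V) : T.pred^[T.l v] v = T.meet T.o v := by
  obtain ⟨n, hn⟩ := (T.meet_spec T.o v).2.1
  rw [l, ← hn, T.dist_iterate_pred]

theorem iterate_pred_m (v : V) : T.pred^[T.m v] T.o = T.meet T.o v := by
  obtain ⟨n, hn⟩ := (T.meet_spec T.o v).1
  rw [m, ← hn, T.dist_iterate_pred]

/-- Any common ancestor computes the height: passing from the greatest one to a lower one adds the
same amount to both distances. -/
theorem h_eq {v : V} {a b : ℕ} (hab : T.pred^[a] v = T.pred^[b] T.o) : T.h v = (a : ℤ) - b := by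
  obtain ⟨k, hk⟩ := (T.meet_spec T.o v).2.2 (T.pred^[a] v) ⟨b, hab.symm⟩ ⟨a, rfl⟩
  have ha : k + T.l v = a := T.iterate_pred_inj (v := v) (by
    rw [iterate_add_apply, iterate_pred_l, hk])
  have hb : k + T.m v = b := T.iterate_pred_inj (v := T.o) (by
    rw [iterate_add_apply, iterate_pred_m, hk, hab])
  rw [h]
  omega

theorem h_pred (v : V) : T.h (T.pred v) = T.h v - 1 := by
  have h1 : T.pred^[T.l v] v = T.pred^[T.m v] T.o := by rw [iterate_pred_l, iterate_pred_m]
  have h2 : T.pred^[T.l v] (T.pred v) = T.pred^[T.m v + 1] T.o := by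
    rw [← iterate_succ_apply, iterate_succ_apply', h1, iterate_succ_apply']
  rw [T.h_eq h2, T.h_eq h1]
  push_cast
  ring

theorem h_iterate_pred (n : ℕ) (v : V) : T.h (T.pred^[n] v) = T.h v - n := by
  induction n with
  | zero => simp
  | succ n ih => rw [iterate_succ_apply', h_pred, ih]; push_cast; ring

theorem h_meet (v : V) : T.h (T.meet T.o v) = -(T.m v : ℤ) := by
  rw [← iterate_pred_m, h_iterate_pred, h_o, zero_sub]

variable {T}

theorem IsAncestor.trans {u v w : V} (h1 : T.IsAncestor u v) (h2 : T.IsAncestor v w) :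
    T.IsAncestor u w := by
  obtain ⟨a, rfl⟩ := h1
  obtain ⟨b, rfl⟩ := h2
  exact ⟨a + b, iterate_add_apply _ _ _ _⟩

theorem IsAncestor.h_le {u v : V} (huv : T.IsAncestor u v) : T.h u ≤ T.h v := by
  obtain ⟨n, rfl⟩ := huv
  rw [h_iterate_pred]
  omega

/-- Among two ancestors of the same vertex, the lower one is an ancestor of the higher one. -/
theorem IsAncestor.of_h_le {u v w : V} (hu : T.IsAncestor u w) (hv : T.IsAncestor v w)
    (huv : T.h u ≤ T.h v) : T.IsAncestor u v := by
  obtain ⟨a, rfl⟩ := hu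
  obtain ⟨b, rfl⟩ := hv
  rw [h_iterate_pred, h_iterate_pred] at huv
  exact ⟨a - b, by rw [← iterate_add_apply, Nat.sub_add_cancel (by omega)]⟩

theorem h_le_of_common_ancestor_o {u v : V} (ho : T.IsAncestor u T.o) (hv : T.IsAncestor u v) :
    T.h u ≤ -(T.m v : ℤ) :=
  T.h_meet v ▸ ((T.meet_spec T.o v).2.2 u ho hv).h_le

/-- The ancestors of `v` form a chain, so `u` is comparable with `o ⋏ v`. If `u` is the lower one,
it is an ancestor of `o` as well as of `w`; if `o ⋏ v` is lower, it is a common ancestor of `o` and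
`w`, which contradicts `m v < m w`. -/
theorem h_le_of_m_lt {u v w : V} (hv : T.IsAncestor u v) (hw : T.IsAncestor u w)
    (hm : T.m v < T.m w) : T.h u ≤ -(T.m w : ℤ) := by
  by_contra! hu
  obtain ⟨gv1, gv2, -⟩ := T.meet_spec T.o v
  have hg := T.h_meet v
  rcases le_total (T.h u) (T.h (T.meet T.o v)) with hle | hle
  · have := h_le_of_common_ancestor_o ((hv.of_h_le gv2 hle).trans gv1) hw
    omega
  · have := h_le_of_common_ancestor_o gv1 ((gv2.of_h_le hv hle).trans hw)
    omega

/-- A common ancestor of `v` and a vertex `w` of height zero lies below both `o ⋏ v` and `o ⋏ w`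
as soon as these are different or equal to `o`. -/
theorem h_le_neg_max {u v w : V} (hv : T.IsAncestor u v) (hw : T.IsAncestor u w)
    (h0 : T.h w = 0) (hm : T.m v ≠ 0 → T.m w ≠ T.m v) :
    T.h u ≤ -(max (T.m v) (T.m w) : ℤ) := by
  rcases lt_trichotomy (T.m v) (T.m w) with hlt | heq | hlt
  · have := h_le_of_m_lt hv hw hlt
    omega
  -- Here `hm` forces both values of `m` to vanish, so the bound is `h w = 0`.
  · have := hw.h_le
    omega
  · have := h_le_of_m_lt hw hv hlt
    omega

theorem meet_isAncestor_of_m_le {v w : V} (hm : T.m w ≤ T.m v) :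
    T.IsAncestor (T.meet T.o v) w := by
  refine IsAncestor.trans ?_ (T.meet_spec T.o w).2.1
  refine (T.meet_spec T.o v).1.of_h_le (T.meet_spec T.o w).1 ?_
  rw [h_meet, h_meet]
  omega

theorem neg_m_le_h (v : V) : -(T.m v : ℤ) ≤ T.h v := by
  rw [h]
  omega

variable (T)

/-- All fibres of `pred` have the same size, and the one over `pred v` contains `v`. -/
theorem exists_pred_eq (v : V) : ∃ w, T.pred w = v := by
  have hne : {w | T.pred w = T.pred v}.encard ≠ 0 := by
    rw [Set.encard_ne_zero]
    exact ⟨v, rfl⟩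
  rw [T.successors, ← T.successors v, Set.encard_ne_zero] at hne
  exact hne

/-- Every vertex lies on a bi-infinite line parametrized by the height. -/
theorem exists_line (v : V) : ∃ L : ℤ → V, L (T.h v) = v ∧ (∀ k, T.pred (L (k + 1)) = L k) ∧
    ∀ k, T.h (L k) = k := by
  choose s hs using T.exists_pred_eq
  let L : ℤ → V := fun k => if T.h v ≤ k then s^[(k - T.h v).toNat] v
    else T.pred^[(T.h v - k).toNat] v
  have hL : ∀ k, T.pred (L (k + 1)) = L k := by
    intro k
    by_cases hk : T.h v ≤ k
    · have : (k + 1 - T.h v).toNat = (k - T.h v).toNat + 1 := by omega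
      simp only [L, if_pos hk, if_pos (show T.h v ≤ k + 1 by omega), this, iterate_succ_apply', hs]
    · by_cases hk' : T.h v = k + 1
      · simp [L, ← hk', if_neg hk, show T.h v - k = 1 by omega]
      · have : (T.h v - k).toNat = (T.h v - (k + 1)).toNat + 1 := by omega
        simp only [L, if_neg hk, if_neg (show ¬ T.h v ≤ k + 1 by omega), this, iterate_succ_apply']
  have h0 : L (T.h v) = v := by simp [L]
  refine ⟨L, h0, hL, fun k => ?_⟩
  have hstep : ∀ k, T.h (L (k + 1)) = T.h (L k) + 1 := by
    intro k
    rw [← hL k, h_pred]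
    ring
  induction k using Int.inductionOn' (b := T.h v) with
  | zero => rw [h0]
  | succ k _ ih => rw [hstep, ih]
  | pred k _ ih =>
    have := hstep (k - 1)
    rw [sub_add_cancel, ih] at this
    omega

end HorocyclicTree

/-! ### Shortening integer height profiles -/

/-- `b` arises from `a` by moving one unit from one coordinate to another (or by doing nothing). -/
def UnitTransfer {d : ℕ} (a b : Fin d → ℤ) : Prop :=
  ∃ i j, b = a + Pi.single i 1 - Pi.single j 1

/-- The number of nonstationary steps among the first `n` steps of a sequence. -/
def moveCount {α : Type*} [DecidableEq α] (n : ℕ) (H : ℕ → α) : ℕ :=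
  ∑ t ∈ Finset.range n, if H t = H (t + 1) then 0 else 1

theorem moveCount_le {α : Type*} [DecidableEq α] (n : ℕ) (H : ℕ → α) : moveCount n H ≤ n := by
  calc moveCount n H ≤ ∑ _t ∈ Finset.range n, 1 := Finset.sum_le_sum fun t _ => by split_ifs <;> simp
    _ = n := by simp

/-- If the `i₀`-th coordinate descends to `b` and ends above it, then one move can be saved by
descending in this coordinate to `b + 1` only. -/
theorem exists_shortened_once {d n : ℕ} {H : ℕ → Fin d → ℤ}
    (hH : ∀ t < n, UnitTransfer (H t) (H (t + 1))) {i₀ : Fin d} {b : ℤ}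
    (h0 : b < H 0 i₀) (hn : b < H n i₀) (hb : ∃ t ≤ n, H t i₀ ≤ b) :
    ∃ H' : ℕ → Fin d → ℤ, H' 0 = H 0 ∧ H' n = H n ∧
      (∀ t < n, UnitTransfer (H' t) (H' (t + 1))) ∧
      (∀ t, ∀ i ≠ i₀, H' t i ≤ H t i) ∧ (∃ t ≤ n, H' t i₀ ≤ b + 1) ∧
      moveCount n H' + 1 ≤ moveCount n H := by
  -- Step `t` is the first descent to `b`; step `s` below is the first return above it.
  have hb' : ∃ t, H t i₀ ≤ b := hb.imp fun _ h => h.2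
  obtain ⟨t, ht⟩ : ∃ t, Nat.find hb' = t + 1 := by
    refine Nat.exists_eq_succ_of_ne_zero fun h => ?_
    have := Nat.find_spec hb'
    rw [h] at this
    omega
  have ht1 : H (t + 1) i₀ ≤ b := ht ▸ Nat.find_spec hb'
  have ht0 : b < H t i₀ := not_le.1 (Nat.find_min hb' (by omega))
  have htn : t + 1 < n := by
    obtain ⟨t', ht', h⟩ := hb
    have h1 : t + 1 ≤ t' := ht ▸ Nat.find_min' hb' h
    have h2 : t + 1 ≠ n := by rintro rfl; omega
    omega
  have hs' : ∃ s, t + 1 ≤ s ∧ b < H s i₀ := ⟨n, htn.le, hn⟩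
  obtain ⟨s, hs⟩ : ∃ s, Nat.find hs' = s + 1 :=
    Nat.exists_eq_succ_of_ne_zero (by have := (Nat.find_spec hs').1; omega)
  have hs1 : t + 1 ≤ s + 1 ∧ b < H (s + 1) i₀ := hs ▸ Nat.find_spec hs'
  have hts : t < s := by
    have : t ≠ s := by rintro rfl; omega
    omega
  have hs0 : H s i₀ ≤ b := by
    have := Nat.find_min hs' (m := s) (by omega)
    push Not at this
    exact this hts
  have hsn : s < n := by
    have : s + 1 ≤ n := hs ▸ Nat.find_min' hs' ⟨htn.le, hn⟩
    omega
  obtain ⟨j, k, htj⟩ := hH t (by omega)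
  obtain ⟨j', k', hsj⟩ := hH s hsn
  have e1 := congrFun htj i₀
  have e2 := congrFun hsj i₀
  simp only [Pi.add_apply, Pi.sub_apply, Pi.single_apply] at e1 e2
  have hk : k = i₀ := by
    by_contra hne
    rw [if_neg (Ne.symm hne)] at e1
    split_ifs at e1 <;> omega
  have hj : j ≠ i₀ := by
    rintro rfl
    rw [if_pos rfl] at e1
    split_ifs at e1 <;> omega
  have hj' : j' = i₀ := by
    by_contra hne
    rw [if_neg (Ne.symm hne)] at e2
    split_ifs at e2 <;> omega
  subst hk hj'
  have e3 : H t j' = b + 1 := by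
    rw [if_neg hj.symm, if_pos rfl] at e1
    omega
  -- Undo the transfer of step `t` until step `s`. The coordinate stays one higher in between, and
  -- coordinate `j` pays for it.
  let D : Fin d → ℤ := Pi.single j' 1 - Pi.single j 1
  let H' : ℕ → Fin d → ℤ := fun r => if t < r ∧ r ≤ s then H r + D else H r
  have hout : ∀ r, ¬ (t < r ∧ r ≤ s) → H' r = H r := fun r hr => if_neg hr
  have hin : ∀ r, t < r → r ≤ s → H' r = H r + D := fun r h1 h2 => if_pos ⟨h1, h2⟩
  have ht' : H' t = H' (t + 1) := by
    rw [hout t (by omega), hin (t + 1) (by omega) (by omega), htj]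
    simp only [D]
    abel
  refine ⟨H', hout 0 (by omega), hout n (by omega), ?_, ?_, ⟨t, by omega, ?_⟩, ?_⟩
  · intro r hr
    by_cases hrt : r = t
    · subst hrt
      exact ⟨j, j, by rw [← ht']; abel⟩
    by_cases hrs : r = s
    · subst hrs
      -- The two transfers merge: `k'` gives its unit directly to `j`.
      refine ⟨j, k', ?_⟩
      rw [hout (r + 1) (by omega), hin r hts le_rfl, hsj]
      simp only [D]
      abel
    obtain ⟨a, c, hac⟩ := hH r hr
    refine ⟨a, c, ?_⟩
    by_cases hr' : t < r ∧ r ≤ s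
    · rw [hin r hr'.1 hr'.2, hin (r + 1) (by omega) (by omega), hac]
      abel
    · rw [hout r hr', hout (r + 1) (by omega), hac]
  · intro r i hi
    by_cases hr : t < r ∧ r ≤ s
    · rw [hin r hr.1 hr.2]
      simp only [D, Pi.add_apply, Pi.sub_apply, Pi.single_apply, if_neg hi]
      split_ifs <;> omega
    · rw [hout r hr]
  · rw [hout t (by omega), e3]
  · have h1 : (∑ r ∈ Finset.range n, if r = t then 1 else 0) = 1 := by
      rw [Finset.sum_ite_eq' , if_pos (Finset.mem_range.2 (by omega))]
    suffices hle : ∀ r, ((if H' r = H' (r + 1) then 0 else 1) + if r = t then 1 else 0) ≤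
        if H r = H (r + 1) then 0 else 1 by
      have h2 := Finset.sum_le_sum fun r (_ : r ∈ Finset.range n) => hle r
      rw [Finset.sum_add_distrib, h1] at h2
      exact h2
    intro r
    by_cases hrt : r = t
    · subst hrt
      have : H r ≠ H (r + 1) := fun h => by have := congrFun h j'; omega
      rw [if_pos ht', if_neg this, if_pos rfl]
    rw [if_neg hrt, add_zero]
    by_cases hrs : r = s
    · subst hrs
      have : H r ≠ H (r + 1) := fun h => by have := congrFun h j'; omega
      rw [if_neg this]
      split_ifs <;> simp
    have hiff : H' r = H' (r + 1) ↔ H r = H (r + 1) := by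
      by_cases hr' : t < r ∧ r ≤ s
      · rw [hin r hr'.1 hr'.2, hin (r + 1) (by omega) (by omega), add_left_inj]
      · rw [hout r hr', hout (r + 1) (by omega)]
    simp only [hiff, le_refl]

/-- Excess depth is removed one unit at a time. A shortening only lowers the other coordinates, so
their descents survive. Stationary steps are kept, so `n` is fixed and only the number of moves
drops. -/
theorem exists_shortened {d n : ℕ} {b : Fin d → ℤ} (S : ℕ) (e : Fin d → ℕ) (he : ∑ i, e i = S)
    {H : ℕ → Fin d → ℤ} (hH : ∀ t < n, UnitTransfer (H t) (H (t + 1)))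
    (h0 : ∀ i, b i ≤ H 0 i) (hn : ∀ i, b i ≤ H n i) (hb : ∀ i, ∃ t ≤ n, H t i ≤ b i - e i) :
    ∃ H' : ℕ → Fin d → ℤ, H' 0 = H 0 ∧ H' n = H n ∧
      (∀ t < n, UnitTransfer (H' t) (H' (t + 1))) ∧
      (∀ i, ∃ t ≤ n, H' t i ≤ b i) ∧ moveCount n H' + S ≤ moveCount n H := by
  induction S generalizing e H with
  | zero =>
    refine ⟨H, rfl, rfl, hH, fun i => ?_, le_rfl⟩
    obtain ⟨t, ht, h⟩ := hb i
    exact ⟨t, ht, by omega⟩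
  | succ S ih =>
    obtain ⟨i₀, -, hi₀⟩ : ∃ i ∈ Finset.univ, e i ≠ 0 :=
      Finset.exists_ne_zero_of_sum_ne_zero (by omega)
    obtain ⟨H₁, h10, h1n, h1, h1le, ⟨t₀, ht₀, h1b⟩, hc⟩ :=
      exists_shortened_once hH (i₀ := i₀) (b := b i₀ - e i₀)
        (by have := h0 i₀; omega) (by have := hn i₀; omega) (hb i₀)
    have hsum : ∑ i, update e i₀ (e i₀ - 1) i = S := by
      have h2 := Finset.sum_update_of_mem (Finset.mem_univ i₀) e (e i₀ - 1)
      have h3 := Finset.add_sum_erase Finset.univ e (Finset.mem_univ i₀)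
      rw [← Finset.sdiff_singleton_eq_erase] at h3
      omega
    obtain ⟨H₂, h20, h2n, h2, h2b, hc'⟩ := ih (update e i₀ (e i₀ - 1)) hsum h1
      (by rwa [h10]) (by rwa [h1n]) (fun i => by
        by_cases hi : i = i₀
        · subst hi
          refine ⟨t₀, ht₀, ?_⟩
          rw [update_self]
          omega
        · obtain ⟨t, ht, h⟩ := hb i
          refine ⟨t, ht, ?_⟩
          rw [update_of_ne hi]
          exact (h1le t i hi).trans h)
    exact ⟨H₂, h20.trans h10, h2n.trans h1n, h2, h2b, by omega⟩

/-! ### Walks versus height profiles -/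

namespace HorocyclicTree

variable {q d : ℕ} {V : Type*} (T : HorocyclicTree q V)

theorem h_of_adj {v w : V} (hvw : T.graph.Adj v w) : T.h w = T.h v + 1 ∨ T.h w = T.h v - 1 := by
  rcases (T.adj_iff v w).1 hvw with rfl | rfl
  · exact Or.inr (T.h_pred v)
  · rw [h_pred]
    omega

/-- A walk in the tree, which may pause, visits a common ancestor of its endpoints. -/
theorem exists_visit_common_ancestor (v : ℕ → V) (n : ℕ)
    (hv : ∀ t < n, v t = v (t + 1) ∨ T.graph.Adj (v t) (v (t + 1))) :
    ∃ t ≤ n, T.IsAncestor (v t) (v 0) ∧ T.IsAncestor (v t) (v n) := by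
  induction n with
  | zero => exact ⟨0, le_rfl, ⟨0, rfl⟩, ⟨0, rfl⟩⟩
  | succ n ih =>
    obtain ⟨t, ht, h0, hn⟩ := ih fun t ht => hv t (by omega)
    rcases hv n n.lt_succ_self with h | h
    · exact ⟨t, by omega, h0, h ▸ hn⟩
    rcases (T.adj_iff _ _).1 h with h | h
    · obtain ⟨k, hk⟩ := hn
      cases k with
      -- The walk goes down from the common ancestor itself, so its new position takes over that
      -- role.
      | zero =>
        refine ⟨n + 1, le_rfl, IsAncestor.trans ⟨1, ?_⟩ h0, ⟨0, rfl⟩⟩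
        rw [← hk]
        exact h
      | succ k => exact ⟨t, by omega, h0, k, by rw [← h, ← hk, iterate_succ_apply]⟩
    · exact ⟨t, by omega, h0, hn.trans ⟨1, h⟩⟩

/-- The two changing heights each move by one, and the zero sum forces opposite signs. -/
theorem unitTransfer_of_adj {x y : T.DLVertex d} (hxy : (T.DL d).Adj x y) :
    UnitTransfer (fun i => T.h (x.1 i)) (fun i => T.h (y.1 i)) := by
  obtain ⟨i, j, hij, hi, hj, hk⟩ := hxy
  have hsum : ∑ k, (T.h (y.1 k) - T.h (x.1 k)) = 0 := by
    rw [Finset.sum_sub_distrib, x.2, y.2, sub_zero]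
  rw [← Finset.sum_subset (Finset.subset_univ {i, j}) (fun k _ h => by
    simp only [Finset.mem_insert, Finset.mem_singleton, not_or] at h
    rw [hk k h.1 h.2, sub_self]), Finset.sum_pair hij] at hsum
  have key : ∀ a b : Fin d, a ≠ b → T.h (y.1 a) = T.h (x.1 a) + 1 →
      T.h (y.1 b) = T.h (x.1 b) - 1 → (∀ k, k ≠ a → k ≠ b → x.1 k = y.1 k) →
      UnitTransfer (fun i => T.h (x.1 i)) (fun i => T.h (y.1 i)) := by
    intro a b hab ha hb h
    refine ⟨a, b, funext fun k => ?_⟩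
    simp only [Pi.add_apply, Pi.sub_apply, Pi.single_apply]
    by_cases hka : k = a
    · subst hka
      rw [if_pos rfl, if_neg hab, ha, sub_zero]
    by_cases hkb : k = b
    · subst hkb
      rw [if_neg hka, if_pos rfl, hb, add_zero]
    rw [if_neg hka, if_neg hkb, h k hka hkb, add_zero, sub_zero]
  rcases T.h_of_adj hi with h1 | h1
  · exact key i j hij h1 (by omega) hk
  · exact key j i hij.symm (by omega) h1 fun k h2 h3 => hk k h3 h2

theorem eq_or_adj_of_adj {x y : T.DLVertex d} (hxy : (T.DL d).Adj x y) (k : Fin d) :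
    x.1 k = y.1 k ∨ T.graph.Adj (x.1 k) (y.1 k) := by
  obtain ⟨i, j, hij, hi, hj, hk⟩ := hxy
  by_cases hki : k = i
  · exact Or.inr (hki ▸ hi)
  by_cases hkj : k = j
  · exact Or.inr (hkj ▸ hj)
  exact Or.inl (hk k hki hkj)

/-- The heights along a walk in the Diestel-Leader graph. -/
theorem exists_height_profile {x z : T.DLVertex d} (p : (T.DL d).Walk x z) :
    ∃ H : ℕ → Fin d → ℤ, (∀ i, H 0 i = T.h (x.1 i)) ∧ (∀ i, H p.length i = T.h (z.1 i)) ∧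
      (∀ t < p.length, UnitTransfer (H t) (H (t + 1))) ∧
      ∀ i, ∃ t ≤ p.length, ∃ u, T.IsAncestor u (x.1 i) ∧ T.IsAncestor u (z.1 i) ∧
        H t i = T.h u := by
  refine ⟨fun t i => T.h ((p.getVert t).1 i), fun i => by simp, fun i => by simp,
    fun t ht => T.unitTransfer_of_adj (p.adj_getVert_succ ht), fun i => ?_⟩
  obtain ⟨t, ht, h0, hn⟩ := T.exists_visit_common_ancestor (fun t => (p.getVert t).1 i) p.length
    fun t ht => T.eq_or_adj_of_adj (p.adj_getVert_succ ht) i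
  refine ⟨t, ht, _, ?_, ?_, rfl⟩
  · simpa using h0
  · simpa using hn

/-- Below `u` the right side no longer mentions the line or `v`, so lines through two descendants of
`u` coincide there. -/
theorem line_eq_iterate_pred {L : ℤ → V} {v u : V} (hv : L (T.h v) = v)
    (hL : ∀ k, T.pred (L (k + 1)) = L k) (hu : T.IsAncestor u v) {k : ℤ} (hk : k ≤ T.h u) :
    L k = T.pred^[(T.h u - k).toNat] u := by
  have hit : ∀ (n : ℕ) k, T.pred^[n] (L k) = L (k - n) := by
    intro n
    induction n with
    | zero => simp
    | succ n ih =>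
      intro k
      rw [iterate_succ_apply, ← sub_add_cancel k 1, hL, ih]
      congr 1
      push_cast
      ring
  obtain ⟨a, rfl⟩ := hu
  rw [h_iterate_pred] at hk ⊢
  nth_rewrite 2 [← hv]
  rw [hit, hit]
  congr 1
  omega

/-- An integer sequence which descends to the height of a common ancestor of `x` and `z` is the
sequence of heights of a walk from `x` to `z`. -/
theorem exists_walk_of_heights {x z u : V} (hx : T.IsAncestor u x) (hz : T.IsAncestor u z)
    {f : ℕ → ℤ} {n : ℕ} (h0 : f 0 = T.h x) (hn : f n = T.h z) {t₀ : ℕ} (ht₀ : t₀ ≤ n)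
    (hu : f t₀ ≤ T.h u) :
    ∃ v : ℕ → V, v 0 = x ∧ v n = z ∧ (∀ t, T.h (v t) = f t) ∧
      ∀ t, (f (t + 1) = f t → v (t + 1) = v t) ∧
        (f (t + 1) = f t + 1 ∨ f t = f (t + 1) + 1 → T.graph.Adj (v t) (v (t + 1))) := by
  obtain ⟨L, hLx, hL, hhL⟩ := T.exists_line x
  obtain ⟨M, hMz, hM, hhM⟩ := T.exists_line z
  have hLM : L (f t₀) = M (f t₀) := by
    rw [T.line_eq_iterate_pred hLx hL hx hu, T.line_eq_iterate_pred hMz hM hz hu]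
  have hadj : ∀ N : ℤ → V, (∀ k, T.pred (N (k + 1)) = N k) → ∀ a b, a = b + 1 ∨ b = a + 1 →
      T.graph.Adj (N b) (N a) := by
    rintro N hN a b (rfl | rfl)
    · exact (T.adj_iff _ _).2 (Or.inr (hN b))
    · exact (T.adj_iff _ _).2 (Or.inl (hN a))
  -- Follow the line through `x` up to time `t₀`, then the line through `z`; they agree at height `f
  -- t₀`.
  let v : ℕ → V := fun t => if t ≤ t₀ then L (f t) else M (f t)
  have hvL : ∀ t, t ≤ t₀ → v t = L (f t) := fun t ht => if_pos ht
  have hvM : ∀ t, t₀ ≤ t → v t = M (f t) := by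
    intro t ht
    rcases ht.eq_or_lt with rfl | ht
    · rw [hvL _ le_rfl, hLM]
    · exact if_neg (by omega)
  refine ⟨v, by rw [hvL 0 (Nat.zero_le _), h0, hLx], by rw [hvM n ht₀, hn, hMz], fun t => ?_,
    fun t => ?_⟩
  · rcases le_total t t₀ with ht | ht
    · rw [hvL t ht, hhL]
    · rw [hvM t ht, hhM]
  · rcases Nat.lt_or_ge t t₀ with ht | ht
    · rw [hvL t ht.le, hvL (t + 1) ht]
      exact ⟨fun h => by rw [h], fun h => hadj L hL _ _ h⟩
    · rw [hvM t ht, hvM (t + 1) (by omega)]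
      exact ⟨fun h => by rw [h], fun h => hadj M hM _ _ h⟩

/-- A height profile which visits the height of a common ancestor of the endpoints in each
coordinate is realized by a walk in the Diestel-Leader graph. -/
theorem edist_le_moveCount {x z : T.DLVertex d} {n : ℕ} {H : ℕ → Fin d → ℤ}
    (h0 : ∀ i, H 0 i = T.h (x.1 i)) (hn : ∀ i, H n i = T.h (z.1 i))
    (hH : ∀ t < n, UnitTransfer (H t) (H (t + 1)))
    (hu : ∀ i, ∃ t ≤ n, ∃ u, T.IsAncestor u (x.1 i) ∧ T.IsAncestor u (z.1 i) ∧ H t i ≤ T.h u) :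
    (T.DL d).edist x z ≤ moveCount n H := by
  choose t₀ ht₀ u hux huz hle using hu
  choose v hv0 hvn hvh hstep using fun i =>
    T.exists_walk_of_heights (hux i) (huz i) (f := fun t => H t i) (h0 i) (hn i) (ht₀ i) (hle i)
  have key : ∀ t ≤ n, ∃ y : T.DLVertex d, (∀ i, y.1 i = v i t) ∧
      (T.DL d).edist x y ≤ moveCount t H := by
    intro t
    induction t with
    | zero => exact fun _ => ⟨x, fun i => (hv0 i).symm, by simp⟩
    | succ t ih =>
      intro ht
      obtain ⟨y, hy, hd⟩ := ih (by omega)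
      obtain ⟨a, b, hab⟩ := hH t (by omega)
      have hHt : ∀ i, H (t + 1) i = H t i + (if i = a then 1 else 0) - if i = b then 1 else 0 := by
        intro i
        rw [hab, Pi.sub_apply, Pi.add_apply, Pi.single_apply, Pi.single_apply]
      have hsum : ∑ i, T.h (v i (t + 1)) = 0 := by
        have hy0 := y.2
        simp only [hy, hvh] at hy0
        simp [hvh, hHt, Finset.sum_add_distrib, Finset.sum_sub_distrib, hy0]
      obtain ⟨y', hy'⟩ : ∃ y' : T.DLVertex d, ∀ i, y'.1 i = v i (t + 1) :=
        ⟨⟨fun i => v i (t + 1), hsum⟩, fun _ => rfl⟩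
      refine ⟨y', hy', ?_⟩
      rw [moveCount, Finset.sum_range_succ, ← moveCount]
      push_cast
      refine SimpleGraph.edist_triangle.trans (add_le_add hd ?_)
      -- A stationary step of the profile costs nothing; any other one is an edge.
      by_cases heq : a = b
      · subst heq
        have hst : H t = H (t + 1) := by rw [hab]; abel
        have hyy : y = y' := Subtype.ext <| funext fun i => by
          rw [hy, hy', (hstep i t).1 (congrFun hst i).symm]
        rw [← hyy]
        simp
      · have hne : H t ≠ H (t + 1) := fun h => by
          have h1 := hHt a
          rw [← h, if_pos rfl, if_neg heq] at h1
          omega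
        rw [if_neg hne, SimpleGraph.edist_le_one_iff_adj_or_eq]
        refine Or.inl ⟨a, b, heq, ?_, ?_, fun k hka hkb => ?_⟩
        · rw [hy, hy']
          refine (hstep a t).2 (Or.inl ?_)
          simp [hHt, heq]
        · rw [hy, hy']
          refine (hstep b t).2 (Or.inr ?_)
          simp [hHt, Ne.symm heq]
        · rw [hy, hy']
          refine ((hstep k t).1 ?_).symm
          simp [hHt, hka, hkb]
  obtain ⟨y, hy, hd⟩ := key n le_rfl
  have : y = z := Subtype.ext <| funext fun i => by rw [hy, hvn]
  rwa [this] at hd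

/-! ### Comparison of the distances to `z` and to `id` -/

theorem edist_le_edist_DLid {x z : T.DLVertex d} (hz : ∀ i, T.h (z.1 i) = 0)
    (hm : ∀ i, T.m (z.1 i) ≤ T.m (x.1 i)) :
    (T.DL d).edist x z ≤ (T.DL d).edist x (T.DLid d) := by
  by_cases htop : (T.DL d).edist x (T.DLid d) = ⊤
  · rw [htop]
    exact le_top
  obtain ⟨p, hp⟩ := SimpleGraph.exists_walk_of_edist_ne_top htop
  obtain ⟨H, h0, hn, hH, hu⟩ := T.exists_height_profile p
  rw [← hp]
  refine (T.edist_le_moveCount h0 (n := p.length) (fun i => ?_) hH fun i => ?_).trans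
    (Nat.cast_le.2 (moveCount_le _ _))
  · rw [hn, hz]
    exact T.h_o
  · obtain ⟨t, ht, u, hux, huo, hHu⟩ := hu i
    refine ⟨t, ht, T.meet T.o (x.1 i), (T.meet_spec _ _).2.1, meet_isAncestor_of_m_le (hm i), ?_⟩
    rw [hHu, h_meet]
    exact h_le_of_common_ancestor_o huo hux

theorem edist_DLid_add_le_edist {x z : T.DLVertex d} (hz : ∀ i, T.h (z.1 i) = 0)
    (hm : ∀ i, T.m (x.1 i) ≠ 0 → T.m (z.1 i) ≠ T.m (x.1 i)) :
    (T.DL d).edist x (T.DLid d) + ((∑ i, (T.m (z.1 i) - T.m (x.1 i)) : ℕ) : ℕ∞) ≤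
      (T.DL d).edist x z := by
  by_cases htop : (T.DL d).edist x z = ⊤
  · rw [htop]
    exact le_top
  obtain ⟨p, hp⟩ := SimpleGraph.exists_walk_of_edist_ne_top htop
  obtain ⟨H, h0, hn, hH, hu⟩ := T.exists_height_profile p
  -- The threshold `-m(x_i)` is the depth needed for `id`. Subtraction in `ℕ` truncates, so the
  -- excess equals `max (m(x_i)) (m(z_i)) - m(x_i)`.
  obtain ⟨H', h0', hn', hH', hb', hc⟩ := exists_shortened (b := fun i => -(T.m (x.1 i) : ℤ)) _
    (fun i => T.m (z.1 i) - T.m (x.1 i)) rfl hH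
    (fun i => by rw [h0]; exact neg_m_le_h _) (fun i => by rw [hn, hz]; omega) (fun i => by
      obtain ⟨t, ht, u, hux, huz, hHu⟩ := hu i
      refine ⟨t, ht, ?_⟩
      have := h_le_neg_max hux huz (hz i) (hm i)
      rw [hHu]
      omega)
  have hle : (T.DL d).edist x (T.DLid d) ≤ moveCount p.length H' := by
    refine T.edist_le_moveCount (fun i => by rw [h0', h0]) (fun i => ?_) hH' fun i => ?_
    · rw [hn', hn, hz]
      exact T.h_o.symm
    · obtain ⟨t, ht, h⟩ := hb' i
      refine ⟨t, ht, T.meet T.o (x.1 i), (T.meet_spec _ _).2.1, (T.meet_spec _ _).1, ?_⟩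
      rwa [h_meet]
  rw [← hp]
  calc _ ≤ (moveCount p.length H' : ℕ∞) + _ := by gcongr
    _ ≤ (moveCount p.length H : ℕ∞) := by exact_mod_cast hc
    _ ≤ p.length := Nat.cast_le.2 (moveCount_le _ _)

end HorocyclicTree

theorem mainTheorem8 {V : Type*} {q d : ℕ} (hd : 1 ≤ d) (T : HorocyclicTree q V)
    (x z : T.DLVertex d) (hz : ∀ i, T.h (z.1 i) = 0) :
    (((∀ i, T.m (x.1 i) ≠ 0 → T.m (z.1 i) < T.m (x.1 i)) ∧
        (∀ i, T.m (x.1 i) = 0 → T.m (z.1 i) = 0)) →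
      (T.DL d).edist x z = (T.DL d).edist x (T.DLid d)) ∧
    ((∀ i, T.m (z.1 i) ≤ T.m (x.1 i)) →
      (T.DL d).edist x z ≤ (T.DL d).edist x (T.DLid d)) ∧
    ((∀ i, T.m (x.1 i) ≠ 0 → T.m (z.1 i) ≠ T.m (x.1 i)) →
      (T.DL d).edist x z ≥ (T.DL d).edist x (T.DLid d) +
        ((∑ i, max 0 ((T.m (z.1 i) : ℤ) - (T.m (x.1 i) : ℤ))).toNat : ℕ∞)) := by
  refine ⟨fun ⟨h1, h2⟩ => le_antisymm (T.edist_le_edist_DLid hz fun i => ?_) ?_,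
    T.edist_le_edist_DLid hz, fun hm => ?_⟩
  · by_cases h : T.m (x.1 i) = 0
    · rw [h2 i h]
      exact Nat.zero_le _
    · exact (h1 i h).le
  · exact le_self_add.trans (T.edist_DLid_add_le_edist hz fun i hi => (h1 i hi).ne)
  · have hsum : ∑ i, max 0 ((T.m (z.1 i) : ℤ) - (T.m (x.1 i) : ℤ)) =
        ((∑ i, (T.m (z.1 i) - T.m (x.1 i)) : ℕ) : ℤ) := by
      rw [Nat.cast_sum]
      exact Finset.sum_congr rfl fun i _ => by omega
    rw [hsum, Int.toNat_natCast]
    exact T.edist_DLid_add_le_edist hz hm
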